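/- Let $\mathbb{F}_3=\{0,1,2\}$ be the field of order $3$, let $\mathrm{wt}$ denote the number of nonzero components of a vector, and write vectors of $\mathbb{F}_3^{12}$ as $c=(x_1,\ldots,x_{10},y_1,y_2)$. A ternary $[12,5]$ code is a $5$-dimensional subspace $C$ of $\mathbb{F}_3^{12}$. Consider the following conditions, required for every codeword $c=(x_1,\ldots,x_{10},y_1,y_2)\in C$: (C1) $\mathrm{wt}((x_1,\ldots,x_{10}))\equiv y_1y_2 \pmod 3$; (C2) if $c$ is not the zero vector, then $\mathrm{wt}((x_1,\ldots,x_{10}))\ge 3$; (C3) if $\mathrm{wt}((x_1,\ldots,x_{10}))=3$, then $(y_1,y_2)\ne(0,0)$. Two such codes are called SZ-equivalent if one is the image of the other under a map $$(x_1,\ldots,x_{10},y_1,y_2)\mapsto((-1)^{\alpha_1}x_{\sigma(1)},\ldots,(-1)^{\alpha_{10}}x_{\sigma(10)},(-1)^{\beta}y_{\tau(1)},(-1)^{\beta}y_{\tau(2)})$$ with $\alpha_1,\ldots,\alpha_{10},\beta\in\{0,1\}$, $\sigma\in S_{10}$ and $\tau\in S_2$. Let $C_1,\ldots,C_7\subseteq\mathbb{F}_3^{12}$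 be the row spaces of the following matrices $G_1,\ldots,G_7$, which represent the seven codes of Shimada and Zhang up to SZ-equivalence (each digit is one entry; the blocks have $5$, $5$ and $2$ columns): $$G_1=\left(\begin{array}{c|c|c} 10000&12210&12\\ 01000&01221&12\\ 00100&10122&12\\ 00010&21012&12\\ 00001&22101&12 \end{array}\right)$$ $$G_2=\left(\begin{array}{c|c|c} 10000&00111&11\\ 01000&01011&22\\ 00100&10101&22\\ 00010&11001&11\\ 00001&12210&12 \end{array}\right)$$ $$G_3=\left(\begin{array}{c|c|c} 10000&00111&11\\ 01000&01011&22\\ 00100&10101&22\\ 00010&11001&11\\ 00001&11111&00 \end{array}\right)$$ $$G_4=\left(\begin{array}{c|c|c} 10000&00011&01\\ 01000&01100&01\\ 00100&10101&22\\ 00010&11010&22\\ 00001&11221&01 \end{array}\right)$$ $$G_5=\left(\begin{array}{c|c|c} 10000&00011&01\\ 01000&01100&01\\ 00100&10101&22\\ 00010&11010&22\\ 00001&12222&20 \end{array}\right)$$ $$G_6=\left(\begin{array}{c|c|c} 10000&00011&01\\ 01000&00101&20\\ 00100&01010&20\\ 00010&01100&01\\ 00001&11221&00 \end{array}\right)$$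 $$G_7=\left(\begin{array}{c|c|c} 10000&00011&01\\ 01000&00101&20\\ 00100&01010&20\\ 00010&01100&01\\ 00001&01111&12 \end{array}\right)$$ Theorem. The codes $C_1,\ldots,C_7$ are ternary $[12,5]$ codes satisfying (C1)–(C3), no two of them are SZ-equivalent, and every ternary $[12,5]$ code satisfying (C1)–(C3) is SZ-equivalent to one of them. -/

import Mathlib

/-- The first ten coordinates `(x₁, …, x₁₀)` of a vector `(x₁, …, x₁₀, y₁, y₂)` of `𝔽₃¹²`. -/
def xPart (c : Fin 12 → ZMod 3) : Fin 10 → ZMod 3 := fun i => c (Fin.castAdd 2 i)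

/-- The last two coordinates `(y₁, y₂)` of a vector `(x₁, …, x₁₀, y₁, y₂)` of `𝔽₃¹²`. -/
def yPart (c : Fin 12 → ZMod 3) : Fin 2 → ZMod 3 := fun j => c (Fin.natAdd 10 j)

/-- The number of nonzero components among the first ten coordinates. -/
def xWeight (c : Fin 12 → ZMod 3) : ℕ := hammingNorm (xPart c)

/-- A ternary `[12, 5]` code satisfying the three conditions: for every codeword
`c = (x₁, …, x₁₀, y₁, y₂)`, (C1) `wt (x₁, …, x₁₀) ≡ y₁ y₂ (mod 3)`;
(C2) if `c ≠ 0` then `wt (x₁, …, x₁₀) ≥ 3`;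
(C3) if `wt (x₁, …, x₁₀) = 3` then `(y₁, y₂) ≠ (0, 0)`. -/
structure IsSZCode (C : Submodule (ZMod 3) (Fin 12 → ZMod 3)) : Prop where
  dim : Module.finrank (ZMod 3) C = 5
  c1 : ∀ c ∈ C, (xWeight c : ZMod 3) = yPart c 0 * yPart c 1
  c2 : ∀ c ∈ C, c ≠ 0 → 3 ≤ xWeight c
  c3 : ∀ c ∈ C, xWeight c = 3 → (yPart c 0, yPart c 1) ≠ (0, 0)

/-- The map `(x₁, …, x₁₀, y₁, y₂) ↦
((-1)^α₁ x_σ(1), …, (-1)^α₁₀ x_σ(10), (-1)^β y_τ(1), (-1)^β y_τ(2))`. -/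
def szMap (α : Fin 10 → Fin 2) (β : Fin 2) (σ : Equiv.Perm (Fin 10)) (τ : Equiv.Perm (Fin 2))
    (c : Fin 12 → ZMod 3) : Fin 12 → ZMod 3 :=
  Fin.append (m := 10) (n := 2)
    (fun i => (-1) ^ (α i : ℕ) * xPart c (σ i))
    (fun j => (-1) ^ (β : ℕ) * yPart c (τ j))

/-- SZ-equivalence: `C'` is the image of `C` under one of the maps `szMap α β σ τ`
(these maps form a group). -/
def SZEquiv (C C' : Submodule (ZMod 3) (Fin 12 → ZMod 3)) : Prop :=
  ∃ (α : Fin 10 → Fin 2) (β : Fin 2) (σ : Equiv.Perm (Fin 10)) (τ : Equiv.Perm (Fin 2)),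
    szMap α β σ τ '' (C : Set (Fin 12 → ZMod 3)) = (C' : Set (Fin 12 → ZMod 3))

/-- Generator matrices `(I₅ | A | aᵀ bᵀ)` of the seven codes. -/
def szGen : Fin 7 → Matrix (Fin 5) (Fin 12) (ZMod 3) :=
  ![
    !![1, 0, 0, 0, 0, 1, 2, 2, 1, 0, 1, 2;
       0, 1, 0, 0, 0, 0, 1, 2, 2, 1, 1, 2;
       0, 0, 1, 0, 0, 1, 0, 1, 2, 2, 1, 2;
       0, 0, 0, 1, 0, 2, 1, 0, 1, 2, 1, 2;
       0, 0, 0, 0, 1, 2, 2, 1, 0, 1, 1, 2],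
    !![1, 0, 0, 0, 0, 0, 0, 1, 1, 1, 1, 1;
       0, 1, 0, 0, 0, 0, 1, 0, 1, 1, 2, 2;
       0, 0, 1, 0, 0, 1, 0, 1, 0, 1, 2, 2;
       0, 0, 0, 1, 0, 1, 1, 0, 0, 1, 1, 1;
       0, 0, 0, 0, 1, 1, 2, 2, 1, 0, 1, 2],
    !![1, 0, 0, 0, 0, 0, 0, 1, 1, 1, 1, 1;
       0, 1, 0, 0, 0, 0, 1, 0, 1, 1, 2, 2;
       0, 0, 1, 0, 0, 1, 0, 1, 0, 1, 2, 2;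
       0, 0, 0, 1, 0, 1, 1, 0, 0, 1, 1, 1;
       0, 0, 0, 0, 1, 1, 1, 1, 1, 1, 0, 0],
    !![1, 0, 0, 0, 0, 0, 0, 0, 1, 1, 0, 1;
       0, 1, 0, 0, 0, 0, 1, 1, 0, 0, 0, 1;
       0, 0, 1, 0, 0, 1, 0, 1, 0, 1, 2, 2;
       0, 0, 0, 1, 0, 1, 1, 0, 1, 0, 2, 2;
       0, 0, 0, 0, 1, 1, 1, 2, 2, 1, 0, 1],
    !![1, 0, 0, 0, 0, 0, 0, 0, 1, 1, 0, 1;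
       0, 1, 0, 0, 0, 0, 1, 1, 0, 0, 0, 1;
       0, 0, 1, 0, 0, 1, 0, 1, 0, 1, 2, 2;
       0, 0, 0, 1, 0, 1, 1, 0, 1, 0, 2, 2;
       0, 0, 0, 0, 1, 1, 2, 2, 2, 2, 2, 0],
    !![1, 0, 0, 0, 0, 0, 0, 0, 1, 1, 0, 1;
       0, 1, 0, 0, 0, 0, 0, 1, 0, 1, 2, 0;
       0, 0, 1, 0, 0, 0, 1, 0, 1, 0, 2, 0;
       0, 0, 0, 1, 0, 0, 1, 1, 0, 0, 0, 1;
       0, 0, 0, 0, 1, 1, 1, 2, 2, 1, 0, 0],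
    !![1, 0, 0, 0, 0, 0, 0, 0, 1, 1, 0, 1;
       0, 1, 0, 0, 0, 0, 0, 1, 0, 1, 2, 0;
       0, 0, 1, 0, 0, 0, 1, 0, 1, 0, 2, 0;
       0, 0, 0, 1, 0, 0, 1, 1, 0, 0, 0, 1;
       0, 0, 0, 0, 1, 0, 1, 1, 1, 1, 1, 2]]

/-- The seven codes: the row spaces of the seven generator matrices. -/
def szCode (i : Fin 7) : Submodule (ZMod 3) (Fin 12 → ZMod 3) :=
  Submodule.span (ZMod 3) (Set.range (szGen i).row)

/-! By (C1) the dot product of the `x`-parts of two codewords is `-(y₁ y₂' + y₂ y₁')`. Hence the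
words with `y = 0` form a self-orthogonal code `K` of length `10` and dimension at least `3`,
whose nonzero weights are `6` and `9` by (C2) and (C3). The weights of the combinations of three
words sum to a multiple of `18`, whereas `26 * 6` is not one; so some word has weight `9`, and it
may be taken to be `1⁹0`. Two further words `f`, `g` of `K` map the first nine coordinates to the
affine plane `𝔽₃²`. The weights prescribe how many coordinates go to each line, and since the four
lines through a point cover the rest of the plane once, this prescribes how many go to each point.
Up to equivalence, `K` therefore contains one of two explicit `[10, 3]` codes `K₀`.

In both cases `K₀^⊥ / K₀` is the space `𝔽₃⁴` with the form `diag(-1, -1, -1, 1)`, on which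
symmetries of `K₀` induce all sign changes and all permutations of the first three coordinates.
The code is then determined by a two-dimensional subspace of `K₀^⊥ / K₀ × 𝔽₃²`, generated by two
vectors whose dot products are prescribed by their `y`-parts. Such pairs have few orbits; (C2) and
(C3) rule out some of them, and the others give the seven codes. These are told apart by their
numbers of words whose `x`-part has weight `4` and `5`. -/

local notation "𝔽₃" => ZMod 3

section Monomial

variable {R ι : Type*} [CommRing R]

/-- The monomial transformation `x ↦ (εᵢ x_{s(i)})ᵢ`; it is invertible when `s` is a permutation
and the `εᵢ` are units, but neither is part of the definition. -/
def monomialMap (ε : ι → R) (s : ι → ι) : (ι → R) →ₗ[R] (ι → R) where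
  toFun x i := ε i * x (s i)
  map_add' _ _ := funext fun _ => mul_add ..
  map_smul' _ _ := funext fun _ => mul_left_comm ..

theorem monomialMap_apply (ε : ι → R) (s : ι → ι) (x : ι → R) (i : ι) :
    monomialMap ε s x i = ε i * x (s i) := rfl

theorem monomialMap_monomialMap (ε ε' : ι → R) (s s' : ι → ι) (x : ι → R) :
    monomialMap ε s (monomialMap ε' s' x) =
      monomialMap (fun i => ε i * ε' (s i)) (s' ∘ s) x :=
  funext fun _ => (mul_assoc ..).symm

variable [NoZeroDivisors R]

theorem monomialMap_injective {ε : ι → R} (hε : ∀ i, ε i ≠ 0) (s : Equiv.Perm ι) :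
    Function.Injective (monomialMap ε s) := by
  refine (injective_iff_map_eq_zero _).2 fun x hx => funext fun i => ?_
  simpa [monomialMap_apply, hε] using congrFun hx (s.symm i)

theorem hammingNorm_monomialMap [Fintype ι] [DecidableEq R] {ε : ι → R} (hε : ∀ i, ε i ≠ 0)
    (s : Equiv.Perm ι) (x : ι → R) : hammingNorm (monomialMap ε s x) = hammingNorm x :=
  Finset.card_equiv s fun i => by simp [monomialMap_apply, hε]

end Monomial

section SZMaps

/-- The splitting of a vector of `𝔽₃¹²` into its first ten and its last two coordinates. -/
def partsEquiv : (Fin 12 → 𝔽₃) ≃ₗ[𝔽₃] (Fin 10 → 𝔽₃) × (Fin 2 → 𝔽₃) where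
  toFun c := (xPart c, yPart c)
  map_add' _ _ := rfl
  map_smul' _ _ := rfl
  invFun p := Fin.append (m := 10) (n := 2) p.1 p.2
  left_inv c := Fin.append_castAdd_natAdd (m := 10) (n := 2) (f := c)
  right_inv p := Prod.ext (funext (Fin.append_left p.1 p.2)) (funext (Fin.append_right p.1 p.2))

/-- The vector of `𝔽₃¹²` with given first ten and last two coordinates. -/
abbrev ofParts (x : Fin 10 → 𝔽₃) (y : Fin 2 → 𝔽₃) : Fin 12 → 𝔽₃ := partsEquiv.symm (x, y)

@[simp]
theorem xPart_ofParts (x : Fin 10 → 𝔽₃) (y : Fin 2 → 𝔽₃) : xPart (ofParts x y) = x :=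
  congrArg Prod.fst (partsEquiv.apply_symm_apply (x, y))

@[simp]
theorem yPart_ofParts (x : Fin 10 → 𝔽₃) (y : Fin 2 → 𝔽₃) : yPart (ofParts x y) = y :=
  congrArg Prod.snd (partsEquiv.apply_symm_apply (x, y))

theorem ofParts_xPart_yPart (c : Fin 12 → 𝔽₃) : ofParts (xPart c) (yPart c) = c :=
  partsEquiv.symm_apply_apply c

/-- The maps `szMap` as linear maps, with arbitrary multipliers and index maps. -/
def szLinear (ε : Fin 10 → 𝔽₃) (s : Fin 10 → Fin 10) (η : 𝔽₃) (t : Fin 2 → Fin 2) :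
    (Fin 12 → 𝔽₃) →ₗ[𝔽₃] (Fin 12 → 𝔽₃) :=
  partsEquiv.symm.toLinearMap ∘ₗ (monomialMap ε s).prodMap (monomialMap (fun _ => η) t) ∘ₗ
    partsEquiv.toLinearMap

theorem szLinear_apply (ε : Fin 10 → 𝔽₃) (s : Fin 10 → Fin 10) (η : 𝔽₃) (t : Fin 2 → Fin 2)
    (c : Fin 12 → 𝔽₃) : szLinear ε s η t c =
      ofParts (monomialMap ε s (xPart c)) (monomialMap (fun _ => η) t (yPart c)) := rfl

theorem szLinear_ofParts (ε : Fin 10 → 𝔽₃) (s : Fin 10 → Fin 10) (η : 𝔽₃) (t : Fin 2 → Fin 2)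
    (x : Fin 10 → 𝔽₃) (y : Fin 2 → 𝔽₃) : szLinear ε s η t (ofParts x y) =
      ofParts (monomialMap ε s x) (monomialMap (fun _ => η) t y) := by
  rw [szLinear_apply, xPart_ofParts, yPart_ofParts]

theorem exists_neg_one_pow_eq {a : 𝔽₃} : a ≠ 0 → ∃ k : Fin 2, (-1) ^ (k : ℕ) = a := by
  decide +revert

variable {C C' C'' : Submodule 𝔽₃ (Fin 12 → 𝔽₃)}

theorem szEquiv_iff : SZEquiv C C' ↔ ∃ (ε : Fin 10 → 𝔽₃) (s : Equiv.Perm (Fin 10)) (η : 𝔽₃)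
    (t : Equiv.Perm (Fin 2)), (∀ i, ε i ≠ 0) ∧ η ≠ 0 ∧ C.map (szLinear ε s η t) = C' := by
  constructor
  · rintro ⟨α, β, σ, τ, h⟩
    exact ⟨fun i => (-1) ^ (α i : ℕ), σ, (-1) ^ (β : ℕ), τ,
      fun i => pow_ne_zero _ (by decide), pow_ne_zero _ (by decide), SetLike.coe_injective h⟩
  · rintro ⟨ε, s, η, t, hε, hη, rfl⟩
    choose α hα using fun i => exists_neg_one_pow_eq (hε i)
    obtain ⟨β, rfl⟩ := exists_neg_one_pow_eq hη
    obtain rfl : (fun i => (-1) ^ (α i : ℕ)) = ε := funext hα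
    exact ⟨α, β, s, t, rfl⟩

theorem SZEquiv.trans (h : SZEquiv C C') (h' : SZEquiv C' C'') : SZEquiv C C'' := by
  obtain ⟨ε, s, η, t, hε, hη, rfl⟩ := szEquiv_iff.1 h
  obtain ⟨ε', s', η', t', hε', hη', rfl⟩ := szEquiv_iff.1 h'
  refine szEquiv_iff.2 ⟨fun i => ε' i * ε (s' i), s * s', η' * η, t * t',
    fun i => mul_ne_zero (hε' i) (hε _), mul_ne_zero hη' hη, ?_⟩
  rw [← Submodule.map_comp]
  refine congrArg (C.map ·) (LinearMap.ext fun c => ?_)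
  simp only [LinearMap.comp_apply, szLinear_apply, xPart_ofParts, yPart_ofParts,
    monomialMap_monomialMap, Equiv.Perm.coe_mul]

theorem szLinear_injective {ε : Fin 10 → 𝔽₃} (hε : ∀ i, ε i ≠ 0) (s : Equiv.Perm (Fin 10))
    {η : 𝔽₃} (hη : η ≠ 0) (t : Equiv.Perm (Fin 2)) : Function.Injective (szLinear ε s η t) :=
  partsEquiv.symm.injective.comp <| ((monomialMap_injective hε s).prodMap
    (monomialMap_injective (fun _ => hη) t)).comp partsEquiv.injective

theorem xWeight_szLinear {ε : Fin 10 → 𝔽₃} (hε : ∀ i, ε i ≠ 0) (s : Equiv.Perm (Fin 10)) (η : 𝔽₃)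
    (t : Fin 2 → Fin 2) (c : Fin 12 → 𝔽₃) : xWeight (szLinear ε s η t c) = xWeight c := by
  rw [xWeight, szLinear_apply, xPart_ofParts, hammingNorm_monomialMap hε, xWeight]

theorem mul_monomialMap_const {η : 𝔽₃} (hη : η ≠ 0) (t : Equiv.Perm (Fin 2)) (y : Fin 2 → 𝔽₃) :
    monomialMap (fun _ => η) t y 0 * monomialMap (fun _ => η) t y 1 = y 0 * y 1 := by
  have h1 : η * η = 1 := by decide +revert
  have ht : y (t 0) * y (t 1) = y 0 * y 1 := by
    simpa [Fin.prod_univ_two] using Equiv.prod_comp t y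
  rw [monomialMap_apply, monomialMap_apply, mul_mul_mul_comm, h1, one_mul, ht]

theorem prodMk_eq_zero_iff {y : Fin 2 → 𝔽₃} : (y 0, y 1) = (0, 0) ↔ y = 0 := by
  simp [funext_iff, Fin.forall_fin_two]

theorem IsSZCode.of_szEquiv (hC : IsSZCode C) (h : SZEquiv C C') : IsSZCode C' := by
  obtain ⟨ε, s, η, t, hε, hη, rfl⟩ := szEquiv_iff.1 h
  constructor
  · rw [← (Submodule.equivMapOfInjective _ (szLinear_injective hε s hη t) C).finrank_eq, hC.dim]
  · rintro _ ⟨c, hc, rfl⟩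
    rw [xWeight_szLinear hε, szLinear_apply, yPart_ofParts, mul_monomialMap_const hη, hC.c1 c hc]
  · rintro _ ⟨c, hc, rfl⟩ h0
    rw [xWeight_szLinear hε]
    exact hC.c2 c hc (by rintro rfl; exact h0 (map_zero _))
  · rintro _ ⟨c, hc, rfl⟩ h3 hy
    rw [xWeight_szLinear hε] at h3
    rw [prodMk_eq_zero_iff, szLinear_apply, yPart_ofParts, ← map_zero (monomialMap _ t)] at hy
    exact hC.c3 c hc h3 (prodMk_eq_zero_iff.2 (monomialMap_injective (fun _ => hη) t hy))

end SZMaps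

section SevenCodes

open Matrix

theorem mem_szCode_iff {i : Fin 7} {c : Fin 12 → 𝔽₃} :
    c ∈ szCode i ↔ ∃ m : Fin 5 → 𝔽₃, m ᵥ* szGen i = c := by
  rw [szCode, ← range_vecMulLinear]
  rfl

theorem szGen_submatrix_castLE (i : Fin 7) :
    (szGen i).submatrix id (Fin.castLE (by decide)) = (1 : Matrix (Fin 5) (Fin 5) 𝔽₃) := by
  decide +revert

theorem vecMul_szGen_comp_castLE (i : Fin 7) (m : Fin 5 → 𝔽₃) :
    (m ᵥ* szGen i) ∘ Fin.castLE (by decide) = m := by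
  have h := submatrix_vecMul_equiv (szGen i) m (Equiv.refl _)
    (Fin.castLE (by decide : 5 ≤ 12))
  rw [Equiv.coe_refl, szGen_submatrix_castLE, vecMul_one] at h
  exact h.symm

theorem vecMul_szGen_injective (i : Fin 7) : Function.Injective (· ᵥ* szGen i) :=
  Function.LeftInverse.injective (g := (· ∘ Fin.castLE (by decide))) (vecMul_szGen_comp_castLE i)

theorem isSZCode_szCode (i : Fin 7) : IsSZCode (szCode i) := by
  have h : ∀ m : Fin 5 → 𝔽₃,
      (xWeight (m ᵥ* szGen i) : 𝔽₃) = yPart (m ᵥ* szGen i) 0 * yPart (m ᵥ* szGen i) 1 ∧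
      (m ≠ 0 → 3 ≤ xWeight (m ᵥ* szGen i)) ∧
      (xWeight (m ᵥ* szGen i) = 3 →
        (yPart (m ᵥ* szGen i) 0, yPart (m ᵥ* szGen i) 1) ≠ (0, 0)) := by
    decide +kernel +revert
  constructor
  · rw [szCode, ← range_vecMulLinear,
      LinearMap.finrank_range_of_inj (f := (szGen i).vecMulLinear) (vecMul_szGen_injective i)]
    simp
  · simp only [mem_szCode_iff, forall_exists_index, forall_apply_eq_imp_iff]
    exact fun m => (h m).1
  · simp only [mem_szCode_iff, forall_exists_index, forall_apply_eq_imp_iff]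
    exact fun m hm => (h m).2.1 (by rintro rfl; exact hm (zero_vecMul _))
  · simp only [mem_szCode_iff, forall_exists_index, forall_apply_eq_imp_iff]
    exact fun m => (h m).2.2

/-- The number of codewords with exactly `w` nonzero components among the first ten, an invariant
of SZ-equivalence that separates the seven codes. -/
noncomputable def wordCount (C : Submodule 𝔽₃ (Fin 12 → 𝔽₃)) (w : ℕ) : ℕ :=
  Nat.card {c // c ∈ C ∧ xWeight c = w}

theorem SZEquiv.wordCount_eq {C C' : Submodule 𝔽₃ (Fin 12 → 𝔽₃)} (h : SZEquiv C C') (w : ℕ) :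
    wordCount C w = wordCount C' w := by
  obtain ⟨ε, s, η, t, hε, hη, rfl⟩ := szEquiv_iff.1 h
  refine Nat.card_congr <| .ofBijective
    (fun c => ⟨szLinear ε s η t c.1, ⟨c.1, c.2.1, rfl⟩, xWeight_szLinear hε s η t c.1 ▸ c.2.2⟩)
    ⟨fun c d hcd => ?_, ?_⟩
  · exact Subtype.ext (szLinear_injective hε s hη t (congrArg Subtype.val hcd))
  · rintro ⟨_, ⟨c, hc, rfl⟩, hw⟩
    exact ⟨⟨c, hc, xWeight_szLinear hε s η t c ▸ hw⟩, rfl⟩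

theorem wordCount_szCode (i : Fin 7) (w : ℕ) : wordCount (szCode i) w =
    Fintype.card {m : Fin 5 → 𝔽₃ // xWeight (m ᵥ* szGen i) = w} := by
  rw [← Nat.card_eq_fintype_card]
  refine (Nat.card_congr <| .ofBijective
    (fun m => ⟨m.1 ᵥ* szGen i, mem_szCode_iff.2 ⟨m.1, rfl⟩, m.2⟩) ⟨fun m n hmn => ?_, ?_⟩).symm
  · exact Subtype.ext (vecMul_szGen_injective i (congrArg Subtype.val hmn))
  · rintro ⟨c, hc, hw⟩
    obtain ⟨m, rfl⟩ := mem_szCode_iff.1 hc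
    exact ⟨⟨m, hw⟩, rfl⟩

theorem wordCount_szCode_four_five (i : Fin 7) :
    (wordCount (szCode i) 4, wordCount (szCode i) 5) =
      ![(0, 72), (18, 18), (30, 0), (8, 24), (6, 18), (10, 24), (18, 36)] i := by
  rw [wordCount_szCode, wordCount_szCode]
  decide +kernel +revert

theorem eq_of_szEquiv_szCode {i j : Fin 7} (h : SZEquiv (szCode i) (szCode j)) : i = j := by
  have hij := wordCount_szCode_four_five i
  rw [h.wordCount_eq, h.wordCount_eq, wordCount_szCode_four_five j] at hij
  clear h
  decide +revert

end SevenCodes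

section ShortenedCode

open Matrix

variable {ι : Type*} [Fintype ι]

theorem natCast_hammingNorm (x : ι → 𝔽₃) : (hammingNorm x : 𝔽₃) = x ⬝ᵥ x := by
  have hsq : ∀ a : 𝔽₃, a * a = if a ≠ 0 then 1 else 0 := by decide
  simp only [hammingNorm, dotProduct, hsq, Finset.sum_boole]

variable {C : Submodule 𝔽₃ (Fin 12 → 𝔽₃)}

theorem IsSZCode.dotProduct_self (hC : IsSZCode C) {x : Fin 10 → 𝔽₃} {y : Fin 2 → 𝔽₃}
    (h : ofParts x y ∈ C) : x ⬝ᵥ x = y 0 * y 1 := by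
  simpa [xWeight, natCast_hammingNorm] using hC.c1 _ h

theorem IsSZCode.dotProduct_eq (hC : IsSZCode C) {x x' : Fin 10 → 𝔽₃} {y y' : Fin 2 → 𝔽₃}
    (h : ofParts x y ∈ C) (h' : ofParts x' y' ∈ C) : x ⬝ᵥ x' = -(y 0 * y' 1 + y 1 * y' 0) := by
  have hadd := hC.dotProduct_self (x := x + x') (y := y + y') (by
    simpa only [← map_add, Prod.mk_add_mk] using add_mem h h')
  simp only [add_dotProduct, dotProduct_add, hC.dotProduct_self h, hC.dotProduct_self h',
    dotProduct_comm x' x, Pi.add_apply] at hadd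
  have h3 : (3 : 𝔽₃) = 0 := rfl
  linear_combination -hadd + (x ⬝ᵥ x') * h3

theorem IsSZCode.three_le_hammingNorm (hC : IsSZCode C) {x : Fin 10 → 𝔽₃} {y : Fin 2 → 𝔽₃}
    (h : ofParts x y ∈ C) (hxy : (x, y) ≠ 0) : 3 ≤ hammingNorm x := by
  simpa [xWeight] using hC.c2 _ h (by simpa using hxy)

/-- The codewords of `C` with `y₁ = y₂ = 0`, punctured at these two coordinates. -/
def shortened (C : Submodule 𝔽₃ (Fin 12 → 𝔽₃)) : Submodule 𝔽₃ (Fin 10 → 𝔽₃) :=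
  C.comap (partsEquiv.symm.toLinearMap ∘ₗ LinearMap.inl _ _ _)

/-- The projection of `C` to the last two coordinates. -/
def yProj (C : Submodule 𝔽₃ (Fin 12 → 𝔽₃)) : C →ₗ[𝔽₃] (Fin 2 → 𝔽₃) :=
  (LinearMap.snd 𝔽₃ (Fin 10 → 𝔽₃) (Fin 2 → 𝔽₃) ∘ₗ partsEquiv.toLinearMap).domRestrict C

theorem mem_shortened {x : Fin 10 → 𝔽₃} : x ∈ shortened C ↔ ofParts x 0 ∈ C := Iff.rfl

theorem IsSZCode.hammingNorm_of_mem_shortened (hC : IsSZCode C) {x : Fin 10 → 𝔽₃}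
    (hx : x ∈ shortened C) (h0 : x ≠ 0) : hammingNorm x = 6 ∨ hammingNorm x = 9 := by
  rw [mem_shortened] at hx
  have h1 : ((hammingNorm x : ℕ) : 𝔽₃) = 0 := by simpa [xWeight] using hC.c1 _ hx
  have h2 : 3 ≤ hammingNorm x := by simpa [xWeight] using hC.c2 _ hx (by simpa using h0)
  have h3 : hammingNorm x ≠ 3 := fun h => by simpa [xWeight, h] using hC.c3 _ hx
  have h4 : hammingNorm x ≤ 10 := hammingNorm_le_card_fintype
  rw [ZMod.natCast_eq_zero_iff] at h1
  omega

theorem finrank_range_yProj_add_finrank_shortened (C : Submodule 𝔽₃ (Fin 12 → 𝔽₃)) :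
    Module.finrank 𝔽₃ (yProj C).range + Module.finrank 𝔽₃ (shortened C) =
      Module.finrank 𝔽₃ C := by
  have hinj : Function.Injective (partsEquiv.symm.toLinearMap ∘ₗ
      LinearMap.inl 𝔽₃ (Fin 10 → 𝔽₃) (Fin 2 → 𝔽₃)) :=
    partsEquiv.symm.injective.comp LinearMap.inl_injective
  have hker : (yProj C).ker.map C.subtype = (shortened C).map (partsEquiv.symm.toLinearMap ∘ₗ
      LinearMap.inl 𝔽₃ (Fin 10 → 𝔽₃) (Fin 2 → 𝔽₃)) := by
    ext c
    constructor
    · rintro ⟨c, hc, rfl⟩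
      have hy : yPart c.1 = 0 := hc
      have h : ofParts (xPart c.1) 0 = c.1 := by rw [← hy, ofParts_xPart_yPart]
      exact ⟨xPart c.1, mem_shortened.2 (h.symm ▸ c.2), h⟩
    · rintro ⟨x, hx, rfl⟩
      exact ⟨⟨ofParts x 0, hx⟩, yPart_ofParts x 0, rfl⟩
  rw [← (yProj C).finrank_range_add_finrank_ker, ← Submodule.finrank_map_subtype_eq C, hker,
    (Submodule.equivMapOfInjective _ hinj _).finrank_eq]

theorem IsSZCode.three_le_finrank_shortened (hC : IsSZCode C) :
    3 ≤ Module.finrank 𝔽₃ (shortened C) := by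
  have h := finrank_range_yProj_add_finrank_shortened C
  have h2 : Module.finrank 𝔽₃ (yProj C).range ≤ 2 := by
    simpa using (yProj C).range.finrank_le
  have := hC.dim
  omega

theorem IsSZCode.exists_mem_yPart_eq (hC : IsSZCode C)
    (h3 : Module.finrank 𝔽₃ (shortened C) ≤ 3) (y : Fin 2 → 𝔽₃) : ∃ c ∈ C, yPart c = y := by
  have h := finrank_range_yProj_add_finrank_shortened C
  have htop : (yProj C).range = ⊤ := Submodule.eq_top_of_finrank_eq <| by
    have := Submodule.finrank_le (yProj C).range
    have := hC.dim
    rw [Module.finrank_fin_fun] at *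
    omega
  obtain ⟨c, rfl⟩ := LinearMap.range_eq_top.1 htop y
  exact ⟨c, c.2, rfl⟩

theorem eighteen_dvd_sum_hammingNorm (M : Matrix (Fin 3) ι 𝔽₃) :
    18 ∣ ∑ m, hammingNorm (m ᵥ* M) := by
  -- A nonzero linear form on `𝔽₃³` is nonzero at exactly 18 vectors.
  have hcol : ∀ v : Fin 3 → 𝔽₃, 18 ∣ ∑ m : Fin 3 → 𝔽₃, if m ⬝ᵥ v ≠ 0 then 1 else 0 := by
    decide +kernel
  simp only [hammingNorm, Finset.card_filter]
  rw [Finset.sum_comm]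
  exact Finset.dvd_sum fun j _ => hcol _

theorem IsSZCode.exists_hammingNorm_eq_nine (hC : IsSZCode C) :
    ∃ x ∈ shortened C, hammingNorm x = 9 := by
  by_contra! h9
  obtain ⟨v, hv⟩ := exists_linearIndependent_of_le_finrank hC.three_le_finrank_shortened
  let M : Matrix (Fin 3) (Fin 10) 𝔽₃ := fun l => v l
  have h6 : ∀ m ≠ 0, hammingNorm (m ᵥ* M) = 6 := fun m hm => by
    have hmem : m ᵥ* M = (∑ l, m l • v l : shortened C) := by
      ext j
      simp [M, vecMul, dotProduct]
    rw [hmem]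
    refine (hC.hammingNorm_of_mem_shortened (Subtype.coe_prop _) fun h0 => hm ?_).resolve_right
      (h9 _ (Subtype.coe_prop _))
    exact funext (Fintype.linearIndependent_iff.1 hv m (Subtype.ext h0))
  have hsum : ∑ m, hammingNorm (m ᵥ* M) = 26 * 6 := by
    rw [← Finset.sum_erase (a := 0) _ (by simp),
      Finset.sum_congr rfl fun m hm => h6 m (Finset.ne_of_mem_erase hm)]
    simp
  exact absurd (hsum ▸ eighteen_dvd_sum_hammingNorm M) (by decide)

theorem exists_szEquiv_map_mem (C : Submodule 𝔽₃ (Fin 12 → 𝔽₃)) {ε : Fin 10 → 𝔽₃}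
    (hε : ∀ i, ε i ≠ 0) (s : Equiv.Perm (Fin 10)) (t : Equiv.Perm (Fin 2)) :
    ∃ C', SZEquiv C C' ∧
      ∀ x y, ofParts x y ∈ C → ofParts (monomialMap ε s x) (y ∘ t) ∈ C' := by
  refine ⟨_, szEquiv_iff.2 ⟨ε, s, 1, t, hε, one_ne_zero, rfl⟩, fun x y h => ⟨_, h, ?_⟩⟩
  rw [szLinear_ofParts]
  congr
  exact funext fun i => one_mul _

theorem exists_szEquiv_comp_mem (C : Submodule 𝔽₃ (Fin 12 → 𝔽₃)) (t : Equiv.Perm (Fin 2)) :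
    ∃ C', SZEquiv C C' ∧ ∀ x y, ofParts x y ∈ C → ofParts x (y ∘ t) ∈ C' := by
  obtain ⟨C', h, hC'⟩ := exists_szEquiv_map_mem C (fun _ => one_ne_zero) 1 t
  have hx : ∀ x : Fin 10 → 𝔽₃, monomialMap (fun _ => 1) (1 : Equiv.Perm (Fin 10)) x = x :=
    fun _ => funext fun _ => one_mul _
  exact ⟨C', h, fun x y hxy => hx x ▸ hC' x y hxy⟩

/-- The word `1⁹0`. -/
def nineOnes : Fin 10 → 𝔽₃ := fun i => if i = 9 then 0 else 1

theorem exists_monomialMap_eq_nineOnes {x : Fin 10 → 𝔽₃} (hx : hammingNorm x = 9) :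
    ∃ (ε : Fin 10 → 𝔽₃) (s : Equiv.Perm (Fin 10)),
      (∀ i, ε i ≠ 0) ∧ monomialMap ε s x = nineOnes := by
  obtain ⟨i₀, hi₀⟩ : ∃ i₀, ∀ i, x i = 0 ↔ i = i₀ := by
    have h1 : Finset.card {i | x i = 0} = 1 := by
      have := Finset.card_filter_add_card_filter_not (s := Finset.univ) (fun i => x i = 0)
      rw [Finset.card_univ, Fintype.card_fin] at this
      change Finset.card {i | ¬ x i = 0} = 9 at hx
      omega
    simpa [Finset.card_eq_one, Finset.ext_iff] using h1
  have hs : ∀ i, x (Equiv.swap i₀ 9 i) = 0 ↔ i = 9 := fun i => by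
    rw [hi₀, Equiv.swap_apply_eq_iff, Equiv.swap_apply_left]
  have hsq : ∀ a : 𝔽₃, a ≠ 0 → a * a = 1 := by decide
  refine ⟨fun i => if i = 9 then 1 else x (Equiv.swap i₀ 9 i), Equiv.swap i₀ 9, fun i => ?_,
    funext fun i => ?_⟩ <;> by_cases hi : i = 9
  · simp [hi]
  · simpa [hi] using (hs i).not.2 hi
  · simpa [hi, monomialMap_apply, nineOnes] using (hi₀ i₀).2 rfl
  · simpa [hi, monomialMap_apply, nineOnes] using hsq _ ((hs i).not.2 hi)

theorem IsSZCode.exists_szEquiv_nineOnes_mem (hC : IsSZCode C) :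
    ∃ C', SZEquiv C C' ∧ nineOnes ∈ shortened C' := by
  obtain ⟨x, hx, h9⟩ := hC.exists_hammingNorm_eq_nine
  obtain ⟨ε, s, hε, hxs⟩ := exists_monomialMap_eq_nineOnes h9
  obtain ⟨C', hCC', h⟩ := exists_szEquiv_map_mem C hε s 1
  exact ⟨C', hCC', hxs ▸ h x 0 hx⟩

end ShortenedCode

section PlaneCounts

open Finset

theorem exists_perm_comp_eq_of_card_fiber_eq {α β : Type*} [Fintype α] [DecidableEq β] {f g : α → β}
    (h : ∀ b, #{a | f a = b} = #{a | g a = b}) : ∃ σ : Equiv.Perm α, g ∘ σ = f := by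
  have e : ∀ b, Nonempty ({a // f a = b} ≃ {a // g a = b}) := fun b =>
    ⟨Fintype.equivOfCardEq (by rw [Fintype.card_subtype, Fintype.card_subtype, h b])⟩
  exact ⟨Equiv.ofFiberEquiv fun b => (e b).some, funext (Equiv.ofFiberEquiv_map _)⟩

variable {ι : Type*} [Fintype ι] {f g : ι → 𝔽₃}

/-- Through every other point of the affine plane passes exactly one of the four lines through
`(p, q)`. -/
theorem sum_card_lines (f g : ι → 𝔽₃) (p q : 𝔽₃) :
    #{i | f i = p} + ∑ s, #{i | g i + s * f i = q + s * p} =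
      Fintype.card ι + 3 * #{i | f i = p ∧ g i = q} := by
  have h : ∀ a b p q : 𝔽₃, (if a = p then 1 else 0) +
      ∑ s, (if b + s * a = q + s * p then 1 else 0) = 1 + 3 * if a = p ∧ b = q then 1 else 0 := by
    decide
  simp only [card_filter, Fintype.card_eq_sum_ones, mul_sum]
  rw [sum_comm, ← sum_add_distrib, ← sum_add_distrib]
  exact sum_congr rfl fun i _ => h _ _ _ _

theorem card_point_eq_one (hι : Fintype.card ι = 9) (hf : ∀ t, #{i | f i = t} = 3)
    (hg : ∀ s t, #{i | g i + s * f i = t} = 3) (p q : 𝔽₃) : #{i | f i = p ∧ g i = q} = 1 := by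
  have h := sum_card_lines f g p q
  simp only [hf, hg, hι, sum_const, card_univ, ZMod.card, smul_eq_mul] at h
  omega

theorem card_point_add_card_eq_two {c : 𝔽₃ → 𝔽₃} (hι : Fintype.card ι = 9)
    (hf : ∀ t, #{i | f i = t} = 3)
    (hg : ∀ s t, #{i | g i + s * f i = t} = if t = c s then 1 else 4) (p q : 𝔽₃) :
    #{i | f i = p ∧ g i = q} + #{s | q + s * p = c s} = 2 := by
  have h := sum_card_lines f g p q
  have hk : ∑ s, (if q + s * p = c s then 1 else 4) + 3 * #{s | q + s * p = c s} = 12 := by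
    rw [card_filter, mul_sum, ← sum_add_distrib, sum_congr rfl (g := fun _ => 4), sum_const]
    · rfl
    · intro s _
      split_ifs <;> rfl
  simp only [hf, hg, hι] at h
  omega

theorem exists_affine_card_point_add_card_eq_two {c : 𝔽₃ → 𝔽₃} (hι : Fintype.card ι = 9)
    (hf : ∀ t, #{i | f i = t} = 3)
    (hg : ∀ s t, #{i | g i + s * f i = t} = if t = c s then 1 else 4) :
    ∃ δ a b : 𝔽₃, δ ≠ 0 ∧ ∀ p q : 𝔽₃,
      #{i | δ * (f i - a) = p ∧ δ * (g i - b) = q} +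
        #{s : 𝔽₃ | q + s * p = if s = 2 then 1 else 0} = 2 := by
  obtain ⟨δ, a, b, hc⟩ : ∃ δ a b, ∀ s, c s = b + s * a + if s = 2 then δ else 0 := by
    clear hg
    decide +revert
  have hδ : δ ≠ 0 := by
    rintro rfl
    have := card_point_add_card_eq_two hι hf hg a b
    simp [hc] at this
  have hinv : ∀ x y : 𝔽₃, δ * x = y ↔ x = δ * y := by
    clear hc hg
    decide +revert
  refine ⟨δ, a, b, hδ, card_point_add_card_eq_two hι (fun t => ?_) fun s t => ?_⟩
  · simpa only [hinv, sub_eq_iff_eq_add] using hf (δ * t + a)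
  · have hlin : ∀ i, δ * (g i - b) + s * (δ * (f i - a)) = t ↔
        g i + s * f i = δ * t + b + s * a := fun i => by
      rw [← sub_eq_iff_eq_add, ← sub_eq_iff_eq_add, ← hinv]
      exact Eq.congr_left (by ring)
    have hts : (δ * t + b + s * a = c s) ↔ t = if s = 2 then 1 else 0 := by
      rw [hc, add_assoc, add_comm, add_right_inj, hinv]
      split_ifs <;> simp [(hinv 1 δ).1 (mul_one _)]
    simp only [hlin, hg, hts]

end PlaneCounts

section NormalForm

open Finset

theorem hammingNorm_sub_smul_nineOnes (x : Fin 10 → 𝔽₃) (t : 𝔽₃) :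
    hammingNorm (x - t • nineOnes) + #{i : Fin 9 | x i.castSucc = t} =
      9 + if x 9 = 0 then 0 else 1 := by
  have h9 : hammingNorm (x - t • nineOnes) =
      #{i : Fin 9 | ¬ x i.castSucc = t} + if x 9 = 0 then 0 else 1 := by
    rw [hammingNorm, card_filter, card_filter, Fin.sum_univ_castSucc]
    refine congrArg₂ (· + ·) (sum_congr rfl fun i _ => ?_) ?_
    · have hi : i.castSucc ≠ 9 := (Fin.castSucc_lt_last i).ne
      simp [nineOnes, hi, sub_eq_zero]
    · have hl : Fin.last 9 = 9 := rfl
      simp [nineOnes, hl, ite_not]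
  have h := card_filter_add_card_filter_not (s := univ) fun i : Fin 9 => x i.castSucc = t
  rw [card_univ, Fintype.card_fin] at h
  omega

theorem sum_card_fiber {ι : Type*} [Fintype ι] (f : ι → 𝔽₃) :
    ∑ t, #{i | f i = t} = Fintype.card ι :=
  (card_eq_sum_card_fiberwise (t := univ) fun _ _ => mem_coe.2 (mem_univ _)).symm

variable {C : Submodule 𝔽₃ (Fin 12 → 𝔽₃)} {x : Fin 10 → 𝔽₃}

theorem IsSZCode.card_fiber_eq_three (hC : IsSZCode C) (hj : nineOnes ∈ shortened C)
    (hx : x ∈ shortened C) (h9 : x 9 = 0) (hxj : x ∉ Submodule.span 𝔽₃ {nineOnes}) (t : 𝔽₃) :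
    #{i : Fin 9 | x i.castSucc = t} = 3 := by
  have hle : ∀ t, #{i : Fin 9 | x i.castSucc = t} ≤ 3 := fun t => by
    have h := hammingNorm_sub_smul_nineOnes x t
    have h6 := hC.hammingNorm_of_mem_shortened (sub_mem hx ((shortened C).smul_mem t hj))
      fun h0 => hxj (Submodule.mem_span_singleton.2 ⟨t, (sub_eq_zero.1 h0).symm⟩)
    rw [if_pos h9] at h
    omega
  by_contra hne
  exact (sum_lt_sum (fun t _ => hle t) ⟨t, mem_univ t, lt_of_le_of_ne (hle t) hne⟩).ne
    (sum_card_fiber fun i : Fin 9 => x i.castSucc)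

theorem IsSZCode.exists_card_fiber_eq (hC : IsSZCode C) (hj : nineOnes ∈ shortened C)
    (hx : x ∈ shortened C) (h9 : x 9 ≠ 0) :
    ∃ t₀, ∀ t, #{i : Fin 9 | x i.castSucc = t} = if t = t₀ then 1 else 4 := by
  have h14 : ∀ t, #{i : Fin 9 | x i.castSucc = t} = 1 ∨ #{i : Fin 9 | x i.castSucc = t} = 4 :=
    fun t => by
      have h := hammingNorm_sub_smul_nineOnes x t
      have h6 := hC.hammingNorm_of_mem_shortened (sub_mem hx ((shortened C).smul_mem t hj))
        fun h0 => h9 (by simpa [nineOnes] using congrFun h0 9)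
      rw [if_neg h9] at h
      omega
  obtain ⟨v, hv⟩ : ∃ v : 𝔽₃ → Bool, ∀ t, #{i : Fin 9 | x i.castSucc = t} = if v t then 1 else 4 :=
    ⟨fun t => decide (#{i : Fin 9 | x i.castSucc = t} = 1), fun t => by
      rcases h14 t with h | h <;> simp [h]⟩
  have hsum := sum_card_fiber fun i : Fin 9 => x i.castSucc
  simp only [hv] at hsum ⊢
  have hcount : ∀ v : 𝔽₃ → Bool, (∑ t, if v t then 1 else 4) = 9 →
      ∃ t₀, ∀ t, (if v t then 1 else 4) = if t = t₀ then 1 else 4 := by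
    decide
  exact hcount v hsum

theorem exists_monomialMap_eq_of_card_eq {f g k₁ k₂ : Fin 10 → 𝔽₃} {c : 𝔽₃} (hc : c ≠ 0)
    (h : ∀ p q, #{i : Fin 9 | k₁ i.castSucc = p ∧ k₂ i.castSucc = q} =
      #{i : Fin 9 | f i.castSucc = p ∧ g i.castSucc = q})
    (hf : c * f 9 = k₁ 9) (hg : c * g 9 = k₂ 9) :
    ∃ (ε : Fin 10 → 𝔽₃) (s : Equiv.Perm (Fin 10)), (∀ i, ε i ≠ 0) ∧
      monomialMap ε s nineOnes = nineOnes ∧ monomialMap ε s f = k₁ ∧ monomialMap ε s g = k₂ := by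
  obtain ⟨σ, hσ⟩ := exists_perm_comp_eq_of_card_fiber_eq
    (f := fun i : Fin 9 => (k₁ i.castSucc, k₂ i.castSucc))
    (g := fun i => (f i.castSucc, g i.castSucc)) (by simpa [Prod.ext_iff] using h)
  have hσ' : ∀ i, f (σ i).castSucc = k₁ i.castSucc ∧ g (σ i).castSucc = k₂ i.castSucc :=
    fun i => Prod.ext_iff.1 (congrFun hσ i)
  let s : Equiv.Perm (Fin 10) := finSuccEquivLast.trans (σ.optionCongr.trans finSuccEquivLast.symm)
  have hs : ∀ i : Fin 9, s i.castSucc = (σ i).castSucc := fun i => by simp [s]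
  have hs9 : s 9 = 9 := by
    change finSuccEquivLast.symm ((finSuccEquivLast (Fin.last 9)).map σ) = Fin.last 9
    rw [finSuccEquivLast_last, Option.map_none, finSuccEquivLast_symm_none]
  have hne : ∀ i : Fin 9, i.castSucc ≠ 9 := fun i => (Fin.castSucc_lt_last i).ne
  refine ⟨fun i => if i = 9 then c else 1, s, fun i => ?_, ?_, ?_, ?_⟩
  · beta_reduce
    split_ifs <;> simp [hc]
  all_goals
    refine funext fun i => i.lastCases ?_ fun i => ?_
    · change (if (9 : Fin 10) = 9 then c else 1) * _ = _
      simp [hs9, hf, hg, nineOnes]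
    · simp [monomialMap_apply, hs, hne, hσ', nineOnes]

/-- Generators of the code of affine functions on the affine plane of order `3`, extended by a zero
coordinate. -/
def planeWords : Matrix (Fin 3) (Fin 10) 𝔽₃ :=
  !![1, 1, 1, 1, 1, 1, 1, 1, 1, 0;
     0, 0, 0, 1, 1, 1, 2, 2, 2, 0;
     0, 1, 2, 0, 1, 2, 0, 1, 2, 0]

/-- Generators of the code whose ten coordinates are, up to sign, the points of the projective plane
of order `3` counted `2 - n` times, where `n` is the number of lines of a complete quadrilateral
through the point. -/
def quadrilateralWords : Matrix (Fin 3) (Fin 10) 𝔽₃ :=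
  !![1, 1, 1, 1, 1, 1, 1, 1, 1, 0;
     0, 0, 0, 1, 1, 1, 2, 2, 2, 0;
     1, 2, 2, 0, 1, 1, 1, 2, 2, 1]

theorem planeWords_zero : planeWords 0 = nineOnes := by
  decide

theorem quadrilateralWords_zero : quadrilateralWords 0 = nineOnes := by
  decide

theorem exists_mem_not_mem_span {K V : Type*} [DivisionRing K] [AddCommGroup V] [Module K V]
    {D : Submodule K V} {s : Finset V} (h : s.card < Module.finrank K D) :
    ∃ x ∈ D, x ∉ Submodule.span K (s : Set V) :=
  SetLike.not_le_iff_exists.1 fun hle =>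
    h.not_ge ((Submodule.finrank_mono hle).trans (finrank_span_finset_le_card s))

theorem IsSZCode.exists_szEquiv_planeWords_mem (hC : IsSZCode C) (hj : nineOnes ∈ shortened C)
    (h3 : 3 ≤ Module.finrank 𝔽₃ ↥(shortened C ⊓ (LinearMap.proj 9).ker)) :
    ∃ C', SZEquiv C C' ∧ ∀ l, planeWords l ∈ shortened C' := by
  obtain ⟨f, ⟨hf, hf9⟩, hfj⟩ := exists_mem_not_mem_span (s := {nineOnes})
    (h3.trans_lt' (by simp))
  obtain ⟨g, ⟨hg, hg9⟩, hgf⟩ := exists_mem_not_mem_span (s := {f, nineOnes})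
    (h3.trans_lt' (Nat.lt_succ_iff.2 card_le_two))
  rw [coe_singleton] at hfj
  rw [coe_pair] at hgf
  have hgs : ∀ s : 𝔽₃, g + s • f ∉ Submodule.span 𝔽₃ {nineOnes} := fun s hs => hgf <| by
    rw [← add_sub_cancel_right g (s • f)]
    exact sub_mem (Submodule.span_mono (by simp) hs)
      (Submodule.smul_mem _ _ (Submodule.subset_span (by simp)))
  have h1 := card_point_eq_one (Fintype.card_fin 9)
    (hC.card_fiber_eq_three hj hf hf9 hfj) fun s =>
      hC.card_fiber_eq_three hj (add_mem hg (Submodule.smul_mem _ s hf))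
        (by simpa using add_mem hg9 (Submodule.smul_mem _ s hf9)) (hgs s)
  have hk : ∀ p q,
      #{i : Fin 9 | planeWords 1 i.castSucc = p ∧ planeWords 2 i.castSucc = q} = 1 := by
    decide
  obtain ⟨ε, s, hε, hj', hf', hg'⟩ := exists_monomialMap_eq_of_card_eq one_ne_zero
    (fun p q => (hk p q).trans (h1 p q).symm) ((one_mul _).trans hf9) ((one_mul _).trans hg9)
  obtain ⟨C', hCC', h⟩ := exists_szEquiv_map_mem C hε s 1
  exact ⟨C', hCC', Fin.forall_fin_succ.2 ⟨planeWords_zero ▸ hj' ▸ h _ _ hj,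
    Fin.forall_fin_two.2 ⟨hf' ▸ h _ _ hf, hg' ▸ h _ _ hg⟩⟩⟩

theorem finrank_le_finrank_inf_ker_add_one {K V : Type*} [Field K] [AddCommGroup V] [Module K V]
    [FiniteDimensional K V] (D : Submodule K V) (φ : Module.Dual K V) :
    Module.finrank K D ≤ Module.finrank K ↥(D ⊓ φ.ker) + 1 := by
  have h1 := Submodule.finrank_sup_add_finrank_inf_eq D φ.ker
  have h2 := φ.finrank_range_add_finrank_ker
  have h3 := φ.range.finrank_le
  have h4 := (D ⊔ φ.ker).finrank_le
  rw [Module.finrank_self] at h3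
  omega

theorem IsSZCode.exists_mem_shortened_card_add_card_eq_two (hC : IsSZCode C)
    (hj : nineOnes ∈ shortened C)
    (h3 : Module.finrank 𝔽₃ ↥(shortened C ⊓ (LinearMap.proj 9).ker) < 3) :
    ∃ f ∈ shortened C, ∃ g ∈ shortened C, f 9 = 0 ∧ g 9 ≠ 0 ∧ ∀ p q,
      #{i : Fin 9 | f i.castSucc = p ∧ g i.castSucc = q} +
        #{s : 𝔽₃ | q + s * p = if s = 2 then 1 else 0} = 2 := by
  have hle := finrank_le_finrank_inf_ker_add_one (shortened C) (LinearMap.proj 9)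
  have hge := hC.three_le_finrank_shortened
  obtain ⟨f, ⟨hf, hf9 : f 9 = 0⟩, hfj⟩ := exists_mem_not_mem_span (s := {nineOnes})
    (show Finset.card _ < Module.finrank 𝔽₃ ↥(shortened C ⊓ (LinearMap.proj 9).ker) by
      rw [card_singleton]
      omega)
  obtain ⟨g, hg, hg9⟩ : ∃ g ∈ shortened C, g 9 ≠ 0 := by
    by_contra! h
    rw [inf_eq_left.2 h] at h3
    omega
  rw [coe_singleton] at hfj
  choose! c hc using fun s : 𝔽₃ => hC.exists_card_fiber_eq hj
    (add_mem hg (Submodule.smul_mem _ s hf)) (by simpa [hf9] using hg9)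
  obtain ⟨δ, a, b, hδ, h2⟩ := exists_affine_card_point_add_card_eq_two (Fintype.card_fin 9)
    (hC.card_fiber_eq_three hj hf hf9 hfj) hc
  have haff : ∀ x ∈ shortened C, ∀ a, δ • (x - a • nineOnes) ∈ shortened C := fun x hx a =>
    Submodule.smul_mem _ _ (sub_mem hx (Submodule.smul_mem _ _ hj))
  have haff_castSucc : ∀ (x : Fin 10 → 𝔽₃) a (i : Fin 9),
      (δ • (x - a • nineOnes)) i.castSucc = δ * (x i.castSucc - a) := fun x a i => by
    have hi : i.castSucc ≠ 9 := (Fin.castSucc_lt_last i).ne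
    simp [nineOnes, hi]
  refine ⟨_, haff f hf a, _, haff g hg b, ?_, ?_, fun p q => ?_⟩
  · simp [nineOnes, hf9]
  · simpa [nineOnes] using ⟨hδ, hg9⟩
  · simpa only [haff_castSucc] using h2 p q

theorem IsSZCode.exists_szEquiv_quadrilateralWords_mem (hC : IsSZCode C)
    (hj : nineOnes ∈ shortened C)
    (h3 : Module.finrank 𝔽₃ ↥(shortened C ⊓ (LinearMap.proj 9).ker) < 3) :
    ∃ C', SZEquiv C C' ∧ (∀ l, quadrilateralWords l ∈ shortened C') ∧
      ∀ y, ∃ c ∈ C', yPart c = y := by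
  obtain ⟨f, hf, g, hg, hf9, hg9, h2⟩ := hC.exists_mem_shortened_card_add_card_eq_two hj h3
  have hk : ∀ p q,
      #{i : Fin 9 | quadrilateralWords 1 i.castSucc = p ∧ quadrilateralWords 2 i.castSucc = q} +
        #{s : 𝔽₃ | q + s * p = if s = 2 then 1 else 0} = 2 := by
    decide
  have hinv : ∀ x : 𝔽₃, x ≠ 0 → x * x = 1 := by decide
  obtain ⟨ε, s, hε, hj', hf', hg'⟩ := exists_monomialMap_eq_of_card_eq
    (k₁ := quadrilateralWords 1) (k₂ := quadrilateralWords 2) hg9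
    (fun p q => Nat.add_right_cancel ((hk p q).trans (h2 p q).symm))
    (by rw [hf9, mul_zero]; rfl) (hinv _ hg9)
  obtain ⟨C', hCC', h⟩ := exists_szEquiv_map_mem C hε s 1
  refine ⟨C', hCC', Fin.forall_fin_succ.2 ⟨quadrilateralWords_zero ▸ hj' ▸ h _ _ hj,
    Fin.forall_fin_two.2 ⟨hf' ▸ h _ _ hf, hg' ▸ h _ _ hg⟩⟩, fun y => ?_⟩
  have hle := finrank_le_finrank_inf_ker_add_one (shortened C) (LinearMap.proj 9)
  obtain ⟨x, hx, rfl⟩ := hC.exists_mem_yPart_eq (by omega) y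
  exact ⟨_, h _ _ ((ofParts_xPart_yPart x).symm ▸ hx), yPart_ofParts _ _⟩

end NormalForm

section Frames

open Matrix

/-- The Gram matrix `diag(-1, -1, -1, 1)` of the form induced on `K^⊥ / K` by the dot product, where
`K` is the part of a code with `y₁ = y₂ = 0`. -/
def lorentz : Matrix (Fin 4) (Fin 4) 𝔽₃ := diagonal ![-1, -1, -1, 1]

/-- The change of sign of the first coordinate. -/
def signFlip : Module.End 𝔽₃ (Fin 4 → 𝔽₃) := monomialMap ![-1, 1, 1, 1] id

/-- The cyclic rotation of the first three coordinates. -/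
def rotate : Module.End 𝔽₃ (Fin 4 → 𝔽₃) := monomialMap 1 ![1, 2, 0, 3]

/-- The exchange of the second and the third coordinate. -/
def exchange : Module.End 𝔽₃ (Fin 4 → 𝔽₃) := monomialMap 1 ![0, 2, 1, 3]

/-- The endomorphism `T` of `𝔽₃⁴` is induced on the combinations of the rows of `E` by a monomial
transformation that preserves the row space of `K`. -/
def IsFrameSymmetry (K : Matrix (Fin 3) (Fin 10) 𝔽₃) (E : Matrix (Fin 4) (Fin 10) 𝔽₃)
    (T : Module.End 𝔽₃ (Fin 4 → 𝔽₃)) : Prop :=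
  ∃ (ε : Fin 10 → 𝔽₃) (s : Fin 10 → Fin 10), (∀ i, ε i ≠ 0) ∧ Function.Injective s ∧
    (∀ j, monomialMap ε s (E j) = T (Pi.single j 1) ᵥ* E) ∧ ∀ l, ∃ m, monomialMap ε s (m ᵥ* K) = K l

/-- A basis `words` of a self-orthogonal `[10, 3]` code, an orthogonal basis `complement` of a
complement of it in its dual code, and `dual`, which witnesses through `resolution` that these
words together span the dual code. The hyperoctahedral group acts on the first three coordinates
of the complement by symmetries of the code. -/
structure Frame where
  words : Matrix (Fin 3) (Fin 10) 𝔽₃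
  complement : Matrix (Fin 4) (Fin 10) 𝔽₃
  dual : Matrix (Fin 3) (Fin 10) 𝔽₃
  gram : complement * complementᵀ = lorentz
  resolution : dualᵀ * words + wordsᵀ * dual +
    complementᵀ * lorentz * complement = 1
  signFlip : IsFrameSymmetry words complement signFlip
  rotate : IsFrameSymmetry words complement rotate
  exchange : IsFrameSymmetry words complement exchange

/-- The frame of the code of affine functions on the affine plane of order `3`. -/
def planeFrame : Frame where
  words := planeWords
  complement := !![0, 1, 1, 1, 2, 2, 1, 2, 2, 0;
                   0, 2, 2, 1, 1, 2, 1, 2, 1, 0;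
                   0, 2, 2, 1, 2, 1, 1, 1, 2, 0;
                   0, 0, 0, 0, 0, 0, 0, 0, 0, 1]
  dual := !![2, 0, 2, 0, 2, 1, 2, 1, 0, 0;
             1, 0, 2, 2, 2, 1, 0, 1, 0, 0;
             1, 2, 0, 2, 1, 0, 0, 2, 1, 0]
  gram := by decide +kernel
  resolution := by decide +kernel
  signFlip := ⟨![2, 2, 2, 2, 2, 2, 2, 2, 2, 1], ![0, 6, 3, 1, 7, 4, 2, 8, 5, 9],
    by decide, by decide +kernel, by decide +kernel, by decide +kernel⟩
  rotate := ⟨1, ![0, 4, 8, 3, 7, 2, 6, 1, 5, 9],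
    by decide, by decide +kernel, by decide +kernel, by decide +kernel⟩
  exchange := ⟨1, ![0, 1, 2, 6, 7, 8, 3, 4, 5, 9],
    by decide, by decide +kernel, by decide +kernel, by decide +kernel⟩

/-- The frame of the code attached to the complete quadrilateral. -/
def quadrilateralFrame : Frame where
  words := quadrilateralWords
  complement := !![0, 1, 2, 0, 0, 0, 0, 0, 0, 0;
                   0, 0, 0, 0, 1, 2, 0, 0, 0, 0;
                   0, 0, 0, 0, 0, 0, 0, 1, 2, 0;
                   1, 0, 0, 1, 0, 0, 1, 0, 0, 1]
  dual := !![1, 1, 1, 0, 1, 1, 2, 0, 0, 0;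
             2, 1, 1, 0, 0, 0, 1, 2, 2, 0;
             2, 0, 0, 2, 0, 0, 2, 0, 0, 0]
  gram := by decide +kernel
  resolution := by decide +kernel
  signFlip := ⟨1, ![0, 2, 1, 3, 4, 5, 6, 7, 8, 9],
    by decide, by decide +kernel, by decide +kernel, by decide +kernel⟩
  rotate := ⟨![1, 1, 1, 1, 2, 2, 1, 2, 2, 1], ![9, 4, 5, 0, 8, 7, 6, 2, 1, 3],
    by decide, by decide +kernel, by decide +kernel, by decide +kernel⟩
  exchange := ⟨![1, 1, 1, 1, 2, 2, 1, 2, 2, 1], ![9, 1, 2, 3, 8, 7, 6, 5, 4, 0],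
    by decide, by decide +kernel, by decide +kernel, by decide +kernel⟩

end Frames

section Hyperoctahedral

/-- The monoid generated by the sign changes and the permutations of the first three coordinates
and by `-1`, acting on `𝔽₃⁴`. -/
def hyperoctahedral : Submonoid (Module.End 𝔽₃ (Fin 4 → 𝔽₃)) :=
  Submonoid.closure {signFlip, rotate, exchange, -1}

theorem signFlip_mem : signFlip ∈ hyperoctahedral := Submonoid.subset_closure (by simp)

theorem rotate_mem : rotate ∈ hyperoctahedral := Submonoid.subset_closure (by simp)

theorem exchange_mem : exchange ∈ hyperoctahedral := Submonoid.subset_closure (by simp)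

theorem neg_one_mem : -1 ∈ hyperoctahedral := Submonoid.subset_closure (by simp)

theorem monomialMap_one_mem_hyperoctahedral {π : Fin 4 → Fin 4} (hπ : Function.Injective π)
    (h3 : π 3 = 3) : monomialMap 1 π ∈ hyperoctahedral := by
  have h : ∃ (a : Fin 3) (b : Fin 2), ∀ j i,
      (rotate ^ (a : ℕ) * exchange ^ (b : ℕ)) (Pi.single j 1) i =
        monomialMap 1 π (Pi.single j 1) i := by
    decide +kernel +revert
  obtain ⟨a, b, h⟩ := h
  have hπ : rotate ^ (a : ℕ) * exchange ^ (b : ℕ) = monomialMap 1 π := by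
    ext j i
    exact h j i
  exact hπ ▸ mul_mem (pow_mem rotate_mem _) (pow_mem exchange_mem _)

theorem monomialMap_id_mem_hyperoctahedral {δ : Fin 4 → 𝔽₃} (hδ : ∀ i, δ i ≠ 0) :
    monomialMap δ id ∈ hyperoctahedral := by
  have h : ∃ n a b c : Fin 2, ∀ j i,
      ((-1) ^ (n : ℕ) * signFlip ^ (a : ℕ) * (rotate * signFlip ^ (b : ℕ) * rotate) *
        (signFlip ^ (c : ℕ) * rotate)) (Pi.single j 1) i = monomialMap δ id (Pi.single j 1) i := by
    decide +kernel +revert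
  obtain ⟨n, a, b, c, h⟩ := h
  have hδ : (-1) ^ (n : ℕ) * signFlip ^ (a : ℕ) * (rotate * signFlip ^ (b : ℕ) * rotate) *
        (signFlip ^ (c : ℕ) * rotate) = monomialMap δ id := by
    ext j i
    exact h j i
  have hflip : ∀ a, signFlip ^ a ∈ hyperoctahedral := pow_mem signFlip_mem
  exact hδ ▸ mul_mem (mul_mem (mul_mem (pow_mem neg_one_mem _) (hflip _))
    (mul_mem (mul_mem rotate_mem (hflip _)) rotate_mem)) (mul_mem (hflip _) rotate_mem)

theorem monomialMap_mem_hyperoctahedral {δ : Fin 4 → 𝔽₃} (hδ : ∀ i, δ i ≠ 0) {π : Fin 4 → Fin 4}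
    (hπ : Function.Injective π) (h3 : π 3 = 3) : monomialMap δ π ∈ hyperoctahedral := by
  have h : monomialMap δ π = monomialMap δ id * monomialMap 1 π := LinearMap.ext fun p =>
    funext fun i => (congrArg (δ i * ·) (one_mul (p (π i)))).symm
  exact h ▸ mul_mem (monomialMap_id_mem_hyperoctahedral hδ)
    (monomialMap_one_mem_hyperoctahedral hπ h3)

end Hyperoctahedral

section IsotropicVectors

open Matrix

/-- The permutations of the first three of four coordinates. -/
def coordinatePerms : List (Fin 4 → Fin 4) :=
  [![0, 1, 2, 3], ![1, 2, 0, 3], ![2, 0, 1, 3], ![0, 2, 1, 3], ![2, 1, 0, 3], ![1, 0, 2, 3]]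

theorem exists_mem_hyperoctahedral_apply_eq {κ : Type*} {π : Fin 4 → Fin 4}
    (hπ : π ∈ coordinatePerms) {v w : κ → Fin 4 → 𝔽₃}
    (h : ∀ i, ∃ d ≠ 0, ∀ j, d * v j (π i) = w j i) :
    ∃ T ∈ hyperoctahedral, ∀ j, T (v j) = w j := by
  have hperm : ∀ π ∈ coordinatePerms, Function.Injective π ∧ π 3 = 3 := by
    decide +kernel
  choose δ hδ hvw using h
  exact ⟨_, monomialMap_mem_hyperoctahedral hδ (hperm π hπ).1 (hperm π hπ).2,
    fun j => funext fun i => hvw i j⟩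

/-- Representatives of the pairs of isotropic vectors with product `-1`. -/
def isotropicPair : Fin 4 → Fin 2 → Fin 4 → 𝔽₃ :=
  ![![![1, 1, 1, 0], ![1, 1, -1, 0]], ![![1, 1, 1, 0], ![1, 0, 0, 1]],
    ![![1, 0, 0, 1], ![0, 1, 0, -1]], ![![1, 0, 0, 1], ![-1, 0, 0, 1]]]

theorem exists_apply_eq_isotropicPair {v : Fin 2 → Fin 4 → 𝔽₃}
    (h0 : v 0 ⬝ᵥ lorentz *ᵥ v 0 = 0) (h1 : v 1 ⬝ᵥ lorentz *ᵥ v 1 = 0)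
    (h01 : v 0 ⬝ᵥ lorentz *ᵥ v 1 = -1) :
    ∃ n, ∃ t : Equiv.Perm (Fin 2), ∃ T ∈ hyperoctahedral, ∀ j, T (v (t j)) = isotropicPair n j := by
  have h : ∀ u : Fin 4 → 𝔽₃, u ⬝ᵥ lorentz *ᵥ u = 0 → ∀ v : Fin 4 → 𝔽₃, u ⬝ᵥ lorentz *ᵥ v = -1 →
      v ⬝ᵥ lorentz *ᵥ v = 0 → ∃ n, ∃ t : Fin 2, ∃ π ∈ coordinatePerms,
        ∀ i, ∃ d ≠ 0, ∀ j, d * ![u, v] (t + j) (π i) = isotropicPair n j i := by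
    decide +kernel
  obtain ⟨n, t, π, hπ, hd⟩ := h _ h0 _ h01 h1
  have hv : ![v 0, v 1] = v := funext (Fin.forall_fin_two.2 ⟨rfl, rfl⟩)
  exact ⟨n, Equiv.addLeft t, exists_mem_hyperoctahedral_apply_eq hπ (hv ▸ hd)⟩

theorem exists_apply_eq_of_isotropic {p : Fin 4 → 𝔽₃} (hp0 : p ≠ 0)
    (hp : p ⬝ᵥ lorentz *ᵥ p = 0) :
    ∃ T ∈ hyperoctahedral, T p = ![1, 1, 1, 0] ∨ T p = ![1, 0, 0, 1] := by
  have h : ∃ n : Fin 2, ∃ π ∈ coordinatePerms, ∀ i, ∃ d ≠ 0, ∀ _ : Unit,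
      d * p (π i) = ![![1, 1, 1, 0], ![1, 0, 0, 1]] n i := by
    decide +kernel +revert
  obtain ⟨n, π, hπ, hd⟩ := h
  obtain ⟨T, hT, hTp⟩ :=
    exists_mem_hyperoctahedral_apply_eq (κ := Unit) (v := fun _ => p) (w := fun _ => _) hπ hd
  exact ⟨T, hT, by fin_cases n <;> [exact .inl (hTp ()); exact .inr (hTp ())]⟩

theorem exists_apply_eq_of_orthogonal {q : Fin 4 → 𝔽₃} {y : Fin 2 → 𝔽₃}
    (hpq : ![1, 0, 0, 1] ⬝ᵥ lorentz *ᵥ q = 0) (hq : q ⬝ᵥ lorentz *ᵥ q = y 0 * y 1)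
    (hqp : ∀ a : 𝔽₃, q ≠ a • ![1, 0, 0, 1]) :
    ∃ a η : 𝔽₃, ∃ T ∈ hyperoctahedral, T ![1, 0, 0, 1] = ![1, 0, 0, 1] ∧
      (T (η • (q - a • ![1, 0, 0, 1])) = ![0, 1, 1, 0] ∧ η • y = ![1, 1] ∨
        T (η • (q - a • ![1, 0, 0, 1])) = ![0, 1, 0, 0] ∧ η • y = ![1, 2]) := by
  have h : ∀ q : Fin 4 → 𝔽₃, ![1, 0, 0, 1] ⬝ᵥ lorentz *ᵥ q = 0 →
      (∀ a : 𝔽₃, q ≠ a • ![1, 0, 0, 1]) → ∀ y : Fin 2 → 𝔽₃, q ⬝ᵥ lorentz *ᵥ q = y 0 * y 1 →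
      ∃ a η : 𝔽₃, ∃ n : Fin 2, η • y = ![![1, 1], ![1, 2]] n ∧
        ∃ π ∈ coordinatePerms, ∀ i, ∃ d ≠ 0, ∀ j,
          d * ![![1, 0, 0, 1], η • (q - a • ![1, 0, 0, 1])] j (π i) =
            ![![1, 0, 0, 1], ![![0, 1, 1, 0], ![0, 1, 0, 0]] n] j i := by
    decide +kernel
  obtain ⟨a, η, n, hy, π, hπ, hd⟩ := h q hpq hqp y hq
  obtain ⟨T, hT, hTp⟩ := exists_mem_hyperoctahedral_apply_eq (w := ![_, _]) hπ hd
  refine ⟨a, η, T, hT, hTp 0, ?_⟩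
  fin_cases n
  exacts [.inl ⟨hTp 1, hy⟩, .inr ⟨hTp 1, hy⟩]

end IsotropicVectors

namespace Frame

open Matrix

variable (F : Frame) {C : Submodule 𝔽₃ (Fin 12 → 𝔽₃)}

/-- The combination of the rows of the complement with coefficients `p`, extended by `y`. -/
def lift : (Fin 4 → 𝔽₃) × (Fin 2 → 𝔽₃) →ₗ[𝔽₃] (Fin 12 → 𝔽₃) :=
  partsEquiv.symm.toLinearMap ∘ₗ F.complement.vecMulLinear.prodMap LinearMap.id

theorem lift_apply (p : Fin 4 → 𝔽₃) (y : Fin 2 → 𝔽₃) :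
    F.lift (p, y) = ofParts (p ᵥ* F.complement) y := rfl

theorem vecMul_words_mem (hk : ∀ l, F.words l ∈ shortened C) (m : Fin 3 → 𝔽₃) :
    m ᵥ* F.words ∈ shortened C := by
  rw [vecMul_eq_sum]
  exact sum_mem fun l _ => Submodule.smul_mem _ _ (hk l)

theorem exists_szEquiv_of_isFrameSymmetry {T : Module.End 𝔽₃ (Fin 4 → 𝔽₃)}
    (hT : IsFrameSymmetry F.words F.complement T) (hk : ∀ l, F.words l ∈ shortened C) :
    ∃ C', SZEquiv C C' ∧ (∀ l, F.words l ∈ shortened C') ∧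
      ∀ p y, F.lift (p, y) ∈ C → F.lift (T p, y) ∈ C' := by
  obtain ⟨ε, s, hε, hs, hE, hK⟩ := hT
  obtain ⟨C', hCC', h⟩ := exists_szEquiv_map_mem C hε
    (.ofBijective s (Finite.injective_iff_bijective.1 hs)) 1
  have hE' : monomialMap ε s ∘ₗ F.complement.vecMulLinear = F.complement.vecMulLinear ∘ₗ T := by
    ext j : 1
    ext : 1
    simpa [single_one_vecMul, row] using hE j
  refine ⟨C', hCC', fun l => ?_, fun p y hp => ?_⟩
  · obtain ⟨m, hm⟩ := hK l
    exact hm ▸ h _ _ (F.vecMul_words_mem hk m)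
  · have hp' : monomialMap ε s (p ᵥ* F.complement) = T p ᵥ* F.complement :=
      LinearMap.congr_fun hE' p
    rw [lift_apply, ← hp']
    exact h _ _ hp

theorem isFrameSymmetry_neg_one : IsFrameSymmetry F.words F.complement (-1) := by
  refine ⟨-1, id, by simp, Function.injective_id, fun j => ?_, fun l => ⟨-Pi.single l 1, ?_⟩⟩
  · ext i
    simp [monomialMap_apply, neg_vecMul]
  · ext i
    simp [monomialMap_apply, neg_vecMul]

theorem exists_szEquiv_of_mem_hyperoctahedral {T : Module.End 𝔽₃ (Fin 4 → 𝔽₃)}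
    (hT : T ∈ hyperoctahedral) (hk : ∀ l, F.words l ∈ shortened C) :
    ∃ C', SZEquiv C C' ∧ (∀ l, F.words l ∈ shortened C') ∧
      ∀ p y, F.lift (p, y) ∈ C → F.lift (T p, y) ∈ C' := by
  induction hT using Submonoid.closure_induction generalizing C with
  | mem T hT =>
    refine F.exists_szEquiv_of_isFrameSymmetry ?_ hk
    rcases hT with rfl | rfl | rfl | rfl
    exacts [F.signFlip, F.rotate, F.exchange, F.isFrameSymmetry_neg_one]
  | one =>
    refine F.exists_szEquiv_of_isFrameSymmetry ⟨1, id, by simp, Function.injective_id,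
      fun j => ?_, fun l => ⟨Pi.single l 1, ?_⟩⟩ hk <;>
    · ext
      simp [monomialMap_apply]
  | mul S T _ _ hS hT =>
    obtain ⟨C₁, h₁, hk₁, hT₁⟩ := hT hk
    obtain ⟨C₂, h₂, hk₂, hS₂⟩ := hS hk₁
    exact ⟨C₂, h₁.trans h₂, hk₂, fun p y hp => hS₂ _ y (hT₁ p y hp)⟩

theorem dotProduct_lift (p q : Fin 4 → 𝔽₃) :
    (p ᵥ* F.complement) ⬝ᵥ (q ᵥ* F.complement) = p ⬝ᵥ lorentz *ᵥ q := by
  rw [← mulVec_transpose F.complement q, dotProduct_mulVec, vecMul_vecMul, F.gram,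
    ← dotProduct_mulVec]

theorem exists_lift_mem (hC : IsSZCode C) (hk : ∀ l, F.words l ∈ shortened C)
    {x : Fin 10 → 𝔽₃} {y : Fin 2 → 𝔽₃} (h : ofParts x y ∈ C) :
    ∃ p m, F.lift (p, y) ∈ C ∧ x = m ᵥ* F.words + p ᵥ* F.complement := by
  have hkx : F.words *ᵥ x = 0 := funext fun l =>
    (hC.dotProduct_eq (hk l) h).trans (by simp)
  have hx : x = (F.dual *ᵥ x) ᵥ* F.words + (lorentz *ᵥ F.complement *ᵥ x) ᵥ* F.complement := by
    conv_lhs => rw [← one_mulVec x, ← F.resolution]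
    simp only [add_mulVec, ← mulVec_mulVec, hkx, mulVec_zero, zero_add, mulVec_transpose]
  have hsub := sub_mem h (F.vecMul_words_mem hk (F.dual *ᵥ x))
  refine ⟨_, _, ?_, hx⟩
  rw [lift_apply, eq_sub_of_add_eq' hx.symm]
  simpa [← map_sub] using hsub

theorem dotProduct_lorentz_self (hC : IsSZCode C) {p : Fin 4 → 𝔽₃} {y : Fin 2 → 𝔽₃}
    (h : F.lift (p, y) ∈ C) : p ⬝ᵥ lorentz *ᵥ p = y 0 * y 1 :=
  (F.dotProduct_lift p p).symm.trans (hC.dotProduct_self h)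

theorem dotProduct_lorentz (hC : IsSZCode C) {p q : Fin 4 → 𝔽₃} {y z : Fin 2 → 𝔽₃}
    (hp : F.lift (p, y) ∈ C) (hq : F.lift (q, z) ∈ C) :
    p ⬝ᵥ lorentz *ᵥ q = -(y 0 * z 1 + y 1 * z 0) :=
  (F.dotProduct_lift p q).symm.trans (hC.dotProduct_eq hp hq)

theorem eq_zero_of_lift_zero_mem (hC : IsSZCode C) {y : Fin 2 → 𝔽₃} (h : F.lift (0, y) ∈ C) :
    y = 0 := by
  by_contra hy
  rw [lift_apply, zero_vecMul] at h
  simpa using hC.three_le_hammingNorm h (by simpa using hy)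

theorem lift_smul_add_smul_mem {w : Fin 2 → (Fin 4 → 𝔽₃) × (Fin 2 → 𝔽₃)}
    (hw : ∀ j, F.lift (w j) ∈ C) (a : Fin 2 → 𝔽₃) : F.lift (a 0 • w 0 + a 1 • w 1) ∈ C := by
  simpa only [map_add, map_smul] using
    add_mem (C.smul_mem (a 0) (hw 0)) (C.smul_mem (a 1) (hw 1))

theorem three_le_hammingNorm (hC : IsSZCode C) {w : Fin 2 → (Fin 4 → 𝔽₃) × (Fin 2 → 𝔽₃)}
    (hw : ∀ j, F.lift (w j) ∈ C) {a : Fin 2 → 𝔽₃} (h0 : (a 0 • w 0 + a 1 • w 1).2 ≠ 0) :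
    3 ≤ hammingNorm ((a 0 • w 0 + a 1 • w 1).1 ᵥ* F.complement) :=
  hC.three_le_hammingNorm (F.lift_smul_add_smul_mem hw a) fun h => h0 (congrArg Prod.snd h)

theorem two_le_finrank_comap_lift (hC : IsSZCode C) (hk : ∀ l, F.words l ∈ shortened C) :
    2 ≤ Module.finrank 𝔽₃ (C.comap F.lift) := by
  let W := Submodule.span 𝔽₃ (Set.range fun l => ofParts (F.words l) 0)
  have hW : ∀ m, ofParts (m ᵥ* F.words) 0 ∈ W := fun m => by
    have h : ofParts (m ᵥ* F.words) 0 = ∑ l, m l • ofParts (F.words l) 0 := by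
      simp only [← map_smul, ← map_sum, vecMul_eq_sum]
      congr 1
    exact h ▸ sum_mem fun l _ => W.smul_mem _ (Submodule.subset_span ⟨l, rfl⟩)
  have hle : C ≤ (C.comap F.lift).map F.lift ⊔ W := fun c hc => by
    rw [← ofParts_xPart_yPart c] at hc ⊢
    obtain ⟨p, m, hp, hx⟩ := F.exists_lift_mem hC hk hc
    have hsum : ofParts (xPart c) (yPart c) =
        F.lift (p, yPart c) + ofParts (m ᵥ* F.words) 0 := by
      rw [lift_apply, ← map_add, Prod.mk_add_mk, add_zero, add_comm, ← hx]
    rw [hsum]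
    exact Submodule.add_mem_sup ⟨_, hp, rfl⟩ (hW m)
  have h1 := (Submodule.finrank_mono hle).trans (Submodule.finrank_add_le_finrank_add_finrank _ W)
  have h2 := Submodule.finrank_map_le F.lift (C.comap F.lift)
  have h3 : Module.finrank 𝔽₃ W ≤ 3 := finrank_range_le_card _
  have h5 := hC.dim
  omega

theorem forall_exists_lift_mem_or_exists_lift_zero_mem (hC : IsSZCode C)
    (hk : ∀ l, F.words l ∈ shortened C) :
    (∀ y, ∃ p, F.lift (p, y) ∈ C) ∨ ∃ p ≠ 0, F.lift (p, 0) ∈ C := by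
  let f := (LinearMap.snd 𝔽₃ (Fin 4 → 𝔽₃) (Fin 2 → 𝔽₃)).domRestrict (C.comap F.lift)
  by_cases hf : Function.Injective f
  · have hrange := LinearMap.finrank_range_of_inj hf
    have htop : f.range = ⊤ := Submodule.eq_top_of_finrank_eq <| by
      have := f.range.finrank_le
      have := F.two_le_finrank_comap_lift hC hk
      rw [Module.finrank_fin_fun] at *
      omega
    refine .inl fun y => ?_
    obtain ⟨⟨⟨p, _⟩, hp⟩, rfl⟩ := LinearMap.range_eq_top.1 htop y
    exact ⟨p, hp⟩
  · rw [injective_iff_map_eq_zero] at hf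
    push Not at hf
    obtain ⟨⟨⟨p, y⟩, hp⟩, rfl : y = 0, h0⟩ := hf
    exact .inr ⟨p, fun hp0 => h0 (by simp [hp0]), hp⟩

theorem exists_szEquiv_lift_mem_of_isotropic (hC : IsSZCode C)
    (hk : ∀ l, F.words l ∈ shortened C) {p : Fin 4 → 𝔽₃} (hp0 : p ≠ 0)
    (hp : F.lift (p, 0) ∈ C) :
    ∃ C', SZEquiv C C' ∧ (∀ l, F.words l ∈ shortened C') ∧
      (F.lift (![1, 1, 1, 0], 0) ∈ C' ∨ F.lift (![1, 0, 0, 1], 0) ∈ C') := by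
  obtain ⟨T, hT, hTp⟩ := exists_apply_eq_of_isotropic hp0 (F.dotProduct_lorentz_self hC hp)
  obtain ⟨C', hCC', hk', h⟩ := F.exists_szEquiv_of_mem_hyperoctahedral hT hk
  refine ⟨C', hCC', hk', hTp.imp (fun hv => ?_) fun hv => ?_⟩ <;> exact hv ▸ h p 0 hp

theorem exists_lift_mem_and_forall_ne_smul (hC : IsSZCode C)
    (hk : ∀ l, F.words l ∈ shortened C) {p : Fin 4 → 𝔽₃} (hp : F.lift (p, 0) ∈ C) :
    ∃ q y, F.lift (q, y) ∈ C ∧ ∀ a : 𝔽₃, q ≠ a • p := by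
  obtain ⟨⟨q, y⟩, hq : F.lift (q, y) ∈ C, hqp⟩ := exists_mem_not_mem_span (s := {(p, 0)})
    ((F.two_le_finrank_comap_lift hC hk).trans_lt' (by simp))
  refine ⟨q, y, hq, ?_⟩
  rintro a rfl
  have hy : y = 0 := F.eq_zero_of_lift_zero_mem hC <| by
    have h := sub_mem hq (C.smul_mem a hp)
    rw [← map_smul, ← map_sub] at h
    simpa using h
  refine hqp ?_
  rw [Finset.coe_singleton, hy]
  exact Submodule.mem_span_singleton.2 ⟨a, by simp⟩

theorem exists_szEquiv_lift_isotropicPair_mem (hC : IsSZCode C)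
    (hk : ∀ l, F.words l ∈ shortened C) (hy : ∀ y, ∃ p, F.lift (p, y) ∈ C) :
    ∃ n C', SZEquiv C C' ∧ (∀ l, F.words l ∈ shortened C') ∧
      ∀ j, F.lift (isotropicPair n j, Pi.single j 1) ∈ C' := by
  choose v hv using fun j : Fin 2 => hy (Pi.single j 1)
  obtain ⟨n, t, T, hT, hTv⟩ := exists_apply_eq_isotropicPair
    (F.dotProduct_lorentz_self hC (hv 0)) (F.dotProduct_lorentz_self hC (hv 1))
    (F.dotProduct_lorentz hC (hv 0) (hv 1))
  obtain ⟨C₁, h₁, hk₁, hT₁⟩ := F.exists_szEquiv_of_mem_hyperoctahedral hT hk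
  obtain ⟨C₂, h₂, ht⟩ := exists_szEquiv_comp_mem C₁ t
  refine ⟨n, C₂, h₁.trans h₂, fun l => ht _ _ (hk₁ l), fun j => ?_⟩
  have hj : (Pi.single (t j) 1 : Fin 2 → 𝔽₃) ∘ t = Pi.single j 1 :=
    funext fun i => by simp [Pi.single_apply]
  rw [← hTv j, ← hj]
  exact ht _ _ (hT₁ _ _ (hv (t j)))

theorem szEquiv_szCode (hC : IsSZCode C) (hk : ∀ l, F.words l ∈ shortened C)
    {w : Fin 2 → (Fin 4 → 𝔽₃) × (Fin 2 → 𝔽₃)} (hw : ∀ j, F.lift (w j) ∈ C)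
    {ε : Fin 10 → 𝔽₃} (hε : ∀ i, ε i ≠ 0) {s : Fin 10 → Fin 10} (hs : Function.Injective s)
    (t : Equiv.Perm (Fin 2)) {i : Fin 7} (h : ∀ r, ∃ (m : Fin 3 → 𝔽₃) (a : Fin 2 → 𝔽₃),
      szLinear ε s 1 t (ofParts (m ᵥ* F.words) 0 + F.lift (a 0 • w 0 + a 1 • w 1)) = szGen i r) :
    SZEquiv C (szCode i) := by
  refine szEquiv_iff.2
    ⟨ε, .ofBijective s (Finite.injective_iff_bijective.1 hs), 1, t, hε, one_ne_zero, ?_⟩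
  refine (Submodule.eq_of_le_of_finrank_eq (Submodule.span_le.2 ?_) ?_).symm
  · rintro _ ⟨r, rfl⟩
    obtain ⟨m, a, hr⟩ := h r
    exact ⟨_, add_mem (F.vecMul_words_mem hk m) (F.lift_smul_add_smul_mem hw a), hr⟩
  · refine (isSZCode_szCode i).dim.trans (hC.dim.symm.trans ?_)
    exact (Submodule.equivMapOfInjective _ (szLinear_injective hε _ one_ne_zero t) C).finrank_eq

end Frame

section Classification

open Matrix

variable {C : Submodule 𝔽₃ (Fin 12 → 𝔽₃)}

theorem exists_szEquiv_szCode_of_quadrilateralWords_mem (hC : IsSZCode C)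
    (hk : ∀ l, quadrilateralWords l ∈ shortened C) (hy : ∀ y, ∃ c ∈ C, yPart c = y) :
    ∃ i, SZEquiv C (szCode i) := by
  have hp : ∀ y, ∃ p, quadrilateralFrame.lift (p, y) ∈ C := fun y => by
    obtain ⟨c, hc, rfl⟩ := hy y
    rw [← ofParts_xPart_yPart c] at hc
    obtain ⟨p, _, hp, _⟩ := quadrilateralFrame.exists_lift_mem hC hk hc
    exact ⟨p, hp⟩
  obtain ⟨n, C', hCC', hk', hw⟩ :=
    quadrilateralFrame.exists_szEquiv_lift_isotropicPair_mem hC hk hp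
  have hC' := hC.of_szEquiv hCC'
  have hdiff := quadrilateralFrame.three_le_hammingNorm hC' hw (a := ![1, -1]) (by
    change (1 : 𝔽₃) • Pi.single 0 1 + (-1 : 𝔽₃) • Pi.single 1 1 ≠ 0
    decide)
  fin_cases n
  · exact absurd hdiff (by decide)
  · exact ⟨3, hCC'.trans <| quadrilateralFrame.szEquiv_szCode hC' hk' hw
      (ε := ![2, 2, 1, 2, 1, 1, 2, 2, 1, 2]) (by decide)
      (s := ![9, 6, 4, 5, 8, 7, 3, 1, 2, 0]) (by decide) 1 (by decide +kernel)⟩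
  · exact ⟨5, hCC'.trans <| quadrilateralFrame.szEquiv_szCode hC' hk' hw
      (ε := ![1, 1, 2, 2, 2, 2, 1, 1, 1, 1]) (by decide)
      (s := ![5, 1, 2, 4, 7, 8, 9, 3, 0, 6]) (by decide) 1 (by decide +kernel)⟩
  · exact absurd hdiff (by decide)

theorem exists_szEquiv_szCode_of_forall_exists_lift_mem (hC : IsSZCode C)
    (hk : ∀ l, planeWords l ∈ shortened C) (hy : ∀ y, ∃ p, planeFrame.lift (p, y) ∈ C) :
    ∃ i, SZEquiv C (szCode i) := by
  obtain ⟨n, C', hCC', hk', hw⟩ := planeFrame.exists_szEquiv_lift_isotropicPair_mem hC hk hy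
  have hC' := hC.of_szEquiv hCC'
  fin_cases n
  · exact ⟨6, hCC'.trans <| planeFrame.szEquiv_szCode hC' hk' hw
      (ε := ![2, 2, 2, 2, 1, 1, 2, 2, 2, 2]) (by decide)
      (s := ![0, 1, 8, 6, 3, 9, 2, 4, 5, 7]) (by decide) 1 (by decide +kernel)⟩
  · exact ⟨4, hCC'.trans <| planeFrame.szEquiv_szCode hC' hk' hw
      (ε := ![1, 1, 1, 1, 1, 2, 1, 1, 1, 1]) (by decide)
      (s := ![0, 1, 5, 8, 2, 9, 7, 4, 6, 3]) (by decide) (Equiv.swap 0 1) (by decide +kernel)⟩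
  · exact ⟨1, hCC'.trans <| planeFrame.szEquiv_szCode hC' hk' hw
      (ε := ![1, 1, 1, 1, 2, 2, 2, 2, 2, 1]) (by decide)
      (s := ![0, 4, 1, 5, 9, 6, 3, 2, 8, 7]) (by decide) 1 (by decide +kernel)⟩
  · exact absurd (planeFrame.three_le_hammingNorm hC' hw (a := ![1, 1]) (by decide))
      (by decide)

theorem exists_szEquiv_lift_one_zero_zero_one_mem (hC : IsSZCode C)
    (hk : ∀ l, planeWords l ∈ shortened C) {p : Fin 4 → 𝔽₃} (hp0 : p ≠ 0)
    (hp : planeFrame.lift (p, 0) ∈ C) :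
    ∃ C', SZEquiv C C' ∧ (∀ l, planeWords l ∈ shortened C') ∧
      planeFrame.lift (![1, 0, 0, 1], 0) ∈ C' := by
  obtain ⟨C', hCC', hk', h⟩ := planeFrame.exists_szEquiv_lift_mem_of_isotropic hC hk hp0 hp
  refine ⟨C', hCC', hk', h.resolve_left fun h1 => ?_⟩
  exact absurd ((hC.of_szEquiv hCC').hammingNorm_of_mem_shortened
    (add_mem (mem_shortened.2 h1) (hk' 0)) (by decide)) (by decide)

theorem exists_szEquiv_szCode_of_lift_zero_mem (hC : IsSZCode C)
    (hk : ∀ l, planeWords l ∈ shortened C) {p : Fin 4 → 𝔽₃} (hp0 : p ≠ 0)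
    (hp : planeFrame.lift (p, 0) ∈ C) : ∃ i, SZEquiv C (szCode i) := by
  obtain ⟨C₁, h₁, hk₁, he⟩ := exists_szEquiv_lift_one_zero_zero_one_mem hC hk hp0 hp
  have hC₁ := hC.of_szEquiv h₁
  obtain ⟨q, y, hq, hqe⟩ := planeFrame.exists_lift_mem_and_forall_ne_smul hC₁ hk₁ he
  obtain ⟨a, η, T, hT, hTe, hTq⟩ := exists_apply_eq_of_orthogonal
    (by simpa using planeFrame.dotProduct_lorentz hC₁ he hq)
    (planeFrame.dotProduct_lorentz_self hC₁ hq) hqe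
  obtain ⟨C₂, h₂, hk₂, hT₂⟩ := planeFrame.exists_szEquiv_of_mem_hyperoctahedral hT hk₁
  have hC₂ := hC₁.of_szEquiv h₂
  have he₂ := hTe ▸ hT₂ _ _ he
  have hq₂ := hT₂ (η • (q - a • ![1, 0, 0, 1])) (η • y) <| by
    have h := C₁.smul_mem η (sub_mem hq (C₁.smul_mem a he))
    rw [← map_smul, ← map_sub, ← map_smul] at h
    simpa using h
  obtain ⟨hTq, hy⟩ | ⟨hTq, hy⟩ := hTq <;> rw [hTq, hy] at hq₂
  · exact ⟨2, h₁.trans <| h₂.trans <| planeFrame.szEquiv_szCode hC₂ hk₂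
      (w := ![_, _]) (Fin.forall_fin_two.2 ⟨hq₂, he₂⟩)
      (ε := ![2, 1, 1, 2, 1, 1, 1, 2, 2, 2]) (by decide)
      (s := ![9, 0, 1, 2, 5, 4, 3, 6, 7, 8]) (by decide) 1 (by decide +kernel)⟩
  · exact ⟨0, h₁.trans <| h₂.trans <| planeFrame.szEquiv_szCode hC₂ hk₂
      (w := ![_, _]) (Fin.forall_fin_two.2 ⟨hq₂, he₂⟩)
      (ε := ![2, 1, 2, 2, 1, 2, 2, 2, 2, 1]) (by decide)
      (s := ![9, 0, 1, 8, 6, 2, 5, 4, 7, 3]) (by decide) 1 (by decide +kernel)⟩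

theorem exists_szEquiv_szCode_of_planeWords_mem (hC : IsSZCode C)
    (hk : ∀ l, planeWords l ∈ shortened C) : ∃ i, SZEquiv C (szCode i) := by
  obtain hy | ⟨p, hp0, hp⟩ := planeFrame.forall_exists_lift_mem_or_exists_lift_zero_mem hC hk
  · exact exists_szEquiv_szCode_of_forall_exists_lift_mem hC hk hy
  · exact exists_szEquiv_szCode_of_lift_zero_mem hC hk hp0 hp

theorem IsSZCode.exists_szEquiv_szCode_of_nineOnes_mem (hC : IsSZCode C)
    (hj : nineOnes ∈ shortened C) : ∃ i, SZEquiv C (szCode i) := by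
  obtain h3 | h3 := le_or_gt 3 (Module.finrank 𝔽₃ ↥(shortened C ⊓ (LinearMap.proj 9).ker))
  · obtain ⟨C', h, hk⟩ := hC.exists_szEquiv_planeWords_mem hj h3
    obtain ⟨i, hi⟩ := exists_szEquiv_szCode_of_planeWords_mem (hC.of_szEquiv h) hk
    exact ⟨i, h.trans hi⟩
  · obtain ⟨C', h, hk, hy⟩ := hC.exists_szEquiv_quadrilateralWords_mem hj h3
    obtain ⟨i, hi⟩ :=
      exists_szEquiv_szCode_of_quadrilateralWords_mem (hC.of_szEquiv h) hk hy
    exact ⟨i, h.trans hi⟩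

theorem IsSZCode.exists_szEquiv_szCode (hC : IsSZCode C) : ∃ i, SZEquiv C (szCode i) := by
  obtain ⟨C', h, hj⟩ := hC.exists_szEquiv_nineOnes_mem
  obtain ⟨i, hi⟩ := (hC.of_szEquiv h).exists_szEquiv_szCode_of_nineOnes_mem hj
  exact ⟨i, h.trans hi⟩

end Classification

theorem theorem1 :
    (∀ i : Fin 7, IsSZCode (szCode i)) ∧
    (∀ i j : Fin 7, SZEquiv (szCode i) (szCode j) → i = j) ∧
    (∀ C : Submodule (ZMod 3) (Fin 12 → ZMod 3), IsSZCode C →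
      ∃ i : Fin 7, SZEquiv C (szCode i)) :=
  ⟨isSZCode_szCode, fun _ _ => eq_of_szEquiv_szCode, fun _ hC => hC.exists_szEquiv_szCode⟩
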